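/- **Theorem 3.1.** For a real Banach space $Z$ let $\mathcal S(Z)$ be the set of all separable closed linear subspaces of $Z$, partially ordered by inclusion. A set $\mathcal R\subset\mathcal S(Z)$ is *rich* if it is cofinal (every $W\in\mathcal S(Z)$ is contained in some $R\in\mathcal R$) and $\sigma$-complete (every sequence $R_1\subset R_2\subset\cdots$ in $\mathcal R$ has a least upper bound in $\mathcal S(Z)$, and it belongs to $\mathcal R$). A real Banach space $X$ is *Asplund* if every convex continuous function $X\to\mathbb R$ is Fréchet differentiable at some point. For a function $f$ from a real normed space $E$ to $(-\infty,+\infty]$ and $x\in E$ with $f(x)<+\infty$, the *Fréchet subdifferential* $\partial_F f(x)$ is the set of all $x^*\in E^*$ such that for every $\varepsilon>0$ there is $\delta>0$ with $$\frac{1}{\|h\|}\big(f(x+h)-f(x)-\langle x^*,h\rangle\big)>-\varepsilon\quad\text{whenever } h\in E,\ 0<\|h\|<\delta;$$ if $f(x)=+\infty$, then $\partial_F f(x):=\emptyset$. For a closed subspace $V\subset X$ and $B\subset X^*$ put $B|_V:=\{x^*|_V:\ x^*\in B\}\subset V^*$. Let $X$ be an Asplund space and let $f:X\to(-\infty,+\infty]$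 be any proper function, i.e. $f\not\equiv+\infty$. Then there exists a rich family $\mathcal R\subset\mathcal S(X\times X^*)$, all of whose members are rectangles $V\times Y$ with $V\in\mathcal S(X)$ and $Y\in\mathcal S(X^*)$, such that 1. $Y_1\subset Y_2$ whenever $V_1\times Y_1,\ V_2\times Y_2\in\mathcal R$ and $V_1\subset V_2$; 2. for every $V\times Y\in\mathcal R$ the restriction map $Y\ni x^*\mapsto x^*|_V\in V^*$ is an isometry from $Y$ onto $V^*$; 3. for every $V\times Y\in\mathcal R$ and every $v\in V$, $$\big(\partial_Ff(v)\cap Y\big)|_V=\big(\partial_Ff(v)\big)|_V=\partial_F(f|_V)(v).$$ -/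

import Mathlib

/-- A subset `R` of a partially ordered set is *rich* (a *club set*) if it is cofinal and
`σ`-complete: every increasing sequence in `R` has a least upper bound (with respect to the whole
poset) and this bound belongs to `R`. -/
def IsRich {P : Type*} [PartialOrder P] (R : Set P) : Prop :=
  IsCofinal R ∧
    ∀ u : ℕ → P, Monotone u → (∀ n, u n ∈ R) → ∃ r ∈ R, IsLUB (Set.range u) r

/-- `𝒮(Z)`: the separable closed subspaces of the real normed space `Z`, ordered by inclusion. -/
abbrev SepSubspace (Z : Type*) [NormedAddCommGroup Z] [NormedSpace ℝ Z] :=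
  {W : Submodule ℝ Z // IsClosed (W : Set Z) ∧ TopologicalSpace.IsSeparable (W : Set Z)}

/-- The rectangle `V × Y`, as a separable closed subspace of `Z₁ × Z₂`. -/
def SepSubspace.rectangle {Z₁ Z₂ : Type*} [NormedAddCommGroup Z₁] [NormedSpace ℝ Z₁]
    [NormedAddCommGroup Z₂] [NormedSpace ℝ Z₂] (V : SepSubspace Z₁) (Y : SepSubspace Z₂) :
    SepSubspace (Z₁ × Z₂) :=
  ⟨V.1.prod Y.1, by
    rw [Submodule.prod_coe]
    exact ⟨V.2.1.prod Y.2.1, V.2.2.prod Y.2.2⟩⟩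

/-- The family of all rectangles `V × Y` with `V ∈ 𝒮(Z₁)` and `Y ∈ 𝒮(Z₂)`. -/
def rectangles (Z₁ Z₂ : Type*) [NormedAddCommGroup Z₁] [NormedSpace ℝ Z₁]
    [NormedAddCommGroup Z₂] [NormedSpace ℝ Z₂] : Set (SepSubspace (Z₁ × Z₂)) :=
  {W | ∃ (V : SepSubspace Z₁) (Y : SepSubspace Z₂), W = V.rectangle Y}

/-- `X` is an *Asplund space* if every convex continuous real function on `X` is Fréchet
differentiable at some point (completeness of `X` is assumed separately). -/
def IsAsplund (X : Type*) [NormedAddCommGroup X] [NormedSpace ℝ X] : Prop :=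
  ∀ g : X → ℝ, ConvexOn ℝ Set.univ g → Continuous g → ∃ x, DifferentiableAt ℝ g x

/-- The *Fréchet subdifferential* of `f : E → (-∞, +∞]` at `x`: for `f x < +∞` the set of all
`xs ∈ E*` such that for every `ε > 0` there is `δ > 0` with
`f (x + h) - f x - ⟨xs, h⟩ > -ε ‖h‖` whenever `0 < ‖h‖ < δ`; the empty set if `f x = +∞`. -/
def frechetSubdifferential {E : Type*} [NormedAddCommGroup E] [NormedSpace ℝ E]
    (f : E → EReal) (x : E) : Set (StrongDual ℝ E) :=
  {xs | f x < ⊤ ∧ ∀ ε : ℝ, 0 < ε → ∃ δ : ℝ, 0 < δ ∧ ∀ h : E, 0 < ‖h‖ → ‖h‖ < δ →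
    ((-(ε * ‖h‖) : ℝ) : EReal) < f (x + h) - f x - ((xs h : ℝ) : EReal)}

/-- The restriction `xs|_V ∈ V*` of a functional `xs ∈ X*` to the subspace `V`. -/
def dualRestrict {X : Type*} [NormedAddCommGroup X] [NormedSpace ℝ X] (V : Submodule ℝ X)
    (xs : StrongDual ℝ X) : StrongDual ℝ V :=
  xs.comp V.subtypeL

/-! The heart of the matter is to attach to each separable `V` countably many functionals whose
restrictions are dense in `V*`, monotonically and σ-continuously in `V`. The Asplund property yields
small weak* open slices of bounded sets (differentiate the support function). Cutting such slices
off a dual ball transfinitely gives weak* compact convex stages. For a functional `x` on `X`, take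
the first stage whose remainder after cutting contains no functional agreeing with `x` on `V`: the
removed slice does contain one, so its centre approximates `x` on `V`. By Hahn–Banach a point of `V`
separates `x` from the remainder, so the stage is recovered from a nearby point and a rational
number (`IsAsplund.exists_approximating_family`). Locally finite covers choose the points
σ-continuously.

The rich family consists of the rectangles `V × Y`, where `Y` is the closed span of the functionals
attached to `V`, and `V` contains witnesses that norm `Y` and that detect, in rational annuli, small
values of `f` relative to attached functionals. Norming makes restriction an isometry, density makes
it onto, and the witnesses transfer subgradients from `V` to `X`. -/

open Set Filter Topology

/-! ### Small weak* slices in the dual of an Asplund space -/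

/-- Nonempty bounded subsets of the dual of an Asplund space have weak* open slices of small
norm diameter. -/
theorem IsAsplund.exists_small_slice {X : Type*} [NormedAddCommGroup X] [NormedSpace ℝ X]
    (hX : IsAsplund X) {K : Set (WeakDual ℝ X)} (hne : K.Nonempty) {N : ℝ}
    (hN : ∀ k ∈ K, ‖WeakDual.toStrongDual k‖ ≤ N) {ε : ℝ} (hε : 0 < ε) :
    ∃ (x : X) (r : ℝ) (d : StrongDual ℝ X), (∃ k ∈ K, r < k x) ∧
      ∀ k ∈ K, r < k x → ‖WeakDual.toStrongDual k - d‖ ≤ ε := by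
  have hbd : ∀ k ∈ K, ∀ x : X, k x ≤ N * ‖x‖ := fun k hk x =>
    (le_abs_self _).trans (((WeakDual.toStrongDual k).le_opNorm x).trans
      (mul_le_mul_of_nonneg_right (hN k hk) (norm_nonneg _)))
  have hN0 : 0 ≤ N := (norm_nonneg _).trans (hN _ hne.choose_spec)
  set p : X → ℝ := fun x => sSup ((fun k : WeakDual ℝ X => k x) '' K) with hp
  have hB : ∀ x, BddAbove ((fun k : WeakDual ℝ X => k x) '' K) := fun x =>
    ⟨N * ‖x‖, by rintro _ ⟨k, hk, rfl⟩; exact hbd k hk x⟩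
  have hle : ∀ k ∈ K, ∀ x, k x ≤ p x := fun k hk x => le_csSup (hB x) ⟨k, hk, rfl⟩
  have hsup : ∀ x a, (∀ k ∈ K, k x ≤ a) → p x ≤ a := fun x a h =>
    csSup_le (hne.image _) (by rintro _ ⟨k, hk, rfl⟩; exact h k hk)
  have hconv : ConvexOn ℝ univ p := by
    refine ⟨convex_univ, fun x _ y _ a b ha hb _ => hsup _ _ fun k hk => ?_⟩
    have e : k (a • x + b • y) = a * k x + b * k y := by
      simp
    rw [e]
    exact add_le_add (mul_le_mul_of_nonneg_left (hle k hk x) ha)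
      (mul_le_mul_of_nonneg_left (hle k hk y) hb)
  have hcont : Continuous p := by
    refine (LipschitzWith.of_le_add_mul ⟨N, hN0⟩ fun x y => hsup _ _ fun k hk => ?_).continuous
    have e : k x = k y + k (x - y) := by
      have := (WeakDual.toStrongDual k).map_sub x y
      simp only [WeakDual.toStrongDual_apply] at this
      linarith
    rw [e, dist_eq_norm]
    exact add_le_add (hle k hk y) (hbd k hk _)
  obtain ⟨x, hx⟩ := hX p hconv hcont
  have hd := hx.hasFDerivAt
  set d := fderiv ℝ p x
  rw [hasFDerivAt_iff_isLittleO_nhds_zero, Asymptotics.isLittleO_iff] at hd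
  obtain ⟨η, hη, hη'⟩ := Metric.eventually_nhds_iff.1 (hd (half_pos hε))
  set s := η / 2 with hs
  have hs0 : 0 < s := half_pos hη
  -- The depth `ε / 2 * s` of the slice and the differentiability error `ε / 2 * s` at distance `s`
  -- add up to `ε * s`.
  refine ⟨x, p x - ε / 2 * s, d, ?_, fun k hk hkx => ?_⟩
  · obtain ⟨_, ⟨k, hk, rfl⟩, h⟩ := exists_lt_of_lt_csSup (hne.image _)
      (show p x - ε / 2 * s < p x by have := mul_pos (half_pos hε) hs0; linarith)
    exact ⟨k, hk, h⟩
  · have key : ∀ h : X, ‖h‖ = s → (WeakDual.toStrongDual k - d) h ≤ ε * s := by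
      intro h hh
      have h1 := hη' (y := h) (by rw [dist_zero_right, hh, hs]; linarith)
      rw [Real.norm_eq_abs, hh] at h1
      have h2 := (le_abs_self _).trans h1
      have h3 := hle k hk (x + h)
      have e : k (x + h) = k x + k h := (WeakDual.toStrongDual k).map_add x h
      have : (WeakDual.toStrongDual k - d) h = k h - d h := rfl
      rw [this]
      linarith
    have hn : ∀ u : X, 0 < ‖u‖ → (WeakDual.toStrongDual k - d) u ≤ ε * ‖u‖ := by
      intro u hu
      have := key ((s / ‖u‖) • u) (by
        rw [norm_smul, Real.norm_of_nonneg (by positivity)]; field_simp)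
      rw [map_smul, smul_eq_mul, div_mul_eq_mul_div, div_le_iff₀ hu] at this
      have h5 : s * (WeakDual.toStrongDual k - d) u ≤ s * (ε * ‖u‖) := by linarith
      exact le_of_mul_le_mul_left h5 hs0
    refine ContinuousLinearMap.opNorm_le_bound _ hε.le fun y => ?_
    rcases eq_or_ne y 0 with rfl | hy
    · simp
    have hy0 : 0 < ‖y‖ := norm_pos_iff.2 hy
    rw [Real.norm_eq_abs, abs_le]
    have h6 := hn (-y) (by rwa [norm_neg])
    rw [map_neg, norm_neg] at h6
    exact ⟨by linarith, hn y hy0⟩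

/-! ### Transfinite derivation -/

/-- Transfinite iteration of a set operation `cut`, starting from `B`. -/
noncomputable def iterCut {α : Type*} (B : Set α) (cut : Set α → Set α) (a : Ordinal) : Set α :=
  {x | x ∈ B ∧ ∀ b, b < a → x ∈ cut (iterCut B cut b)}
termination_by a

theorem mem_iterCut {α : Type*} {B : Set α} {cut : Set α → Set α} {a : Ordinal} {x : α} :
    x ∈ iterCut B cut a ↔ x ∈ B ∧ ∀ b, b < a → x ∈ cut (iterCut B cut b) := by
  rw [iterCut]
  rfl

theorem iterCut_subset {α : Type*} (B : Set α) (cut : Set α → Set α) (a : Ordinal) :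
    iterCut B cut a ⊆ B := fun _ hx => (mem_iterCut.1 hx).1

theorem iterCut_subset_cut {α : Type*} (B : Set α) (cut : Set α → Set α) {a b : Ordinal}
    (h : b < a) : iterCut B cut a ⊆ cut (iterCut B cut b) := fun _ hx => (mem_iterCut.1 hx).2 b h

/-- Otherwise the stages would decrease strictly along all ordinals, injecting the ordinals into
`Set α`. -/
theorem exists_iterCut_eq_empty.{u} {α : Type u} (B : Set α) (cut : Set α → Set α)
    (hcut : ∀ K ⊆ B, K.Nonempty → cut K ⊂ K) :
    ∃ a : Ordinal.{u}, iterCut B cut a = ∅ := by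
  by_contra! h
  refine not_injective_of_ordinal (iterCut B cut) (StrictAnti.injective fun a b hab => ?_)
  exact (iterCut_subset_cut B cut hab).trans_ssubset (hcut _ (iterCut_subset _ _ _) (h a))

/-- Every stage is `B` intersected with the cuts of the earlier ones, so zero, successor and limit
stages are treated alike; the empty family accounts for stage zero. -/
theorem iterCut_induction {α : Type*} {B : Set α} {cut : Set α → Set α} {p : Set α → Prop}
    (hcut : ∀ K ⊆ B, p K → p (cut K))
    (hinter : ∀ S : Set (Set α), (∀ s ∈ S, p s) → p (B ∩ ⋂₀ S)) (a : Ordinal) :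
    p (iterCut B cut a) := by
  induction a using WellFoundedLT.induction with
  | ind a ih =>
    have : iterCut B cut a = B ∩ ⋂₀ ((fun b => cut (iterCut B cut b)) '' Iio a) := by
      ext x
      rw [mem_iterCut]
      simp
    rw [this]
    refine hinter _ ?_
    rintro _ ⟨b, hb, rfl⟩
    exact hcut _ (iterCut_subset _ _ _) (ih b hb)

/-! ### Approximating functionals indexed by points and rationals -/

/-- A functional on a subspace `V` which is not the restriction of an element of a weak* compact
convex set `K` is strictly separated from `K` by a point of `V`. -/
theorem WeakDual.exists_separating_mem {X : Type*} [NormedAddCommGroup X] [NormedSpace ℝ X]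
    {K : Set (WeakDual ℝ X)} (hK : IsCompact K) (hconv : Convex ℝ K) (V : Submodule ℝ X)
    (x : WeakDual ℝ X) (hx : ∀ z ∈ K, ∃ v ∈ V, z v ≠ x v) :
    ∃ v ∈ V, ∃ r : ℝ, (∀ z ∈ K, z v < r) ∧ r < x v := by
  let ρ : WeakDual ℝ X →L[ℝ] WeakDual ℝ V :=
    { toFun := fun z => StrongDual.toWeakDual (dualRestrict V (WeakDual.toStrongDual z))
      map_add' := fun _ _ => rfl
      map_smul' := fun _ _ => rfl
      cont := WeakDual.continuous_of_continuous_eval fun v =>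
        WeakDual.eval_continuous (v : X) }
  have hρ : ∀ z v, ρ z v = z (v : X) := fun _ _ => rfl
  have hnot : ρ x ∉ ρ '' K := by
    rintro ⟨z, hz, hzx⟩
    obtain ⟨v, hv, hne⟩ := hx z hz
    exact hne (by rw [← hρ z ⟨v, hv⟩, hzx, hρ])
  have : LocallyConvexSpace ℝ (WeakDual ℝ V) :=
    inferInstanceAs (LocallyConvexSpace ℝ (WeakBilin (topDualPairing ℝ V)))
  obtain ⟨g, r, hg, hgx⟩ := geometric_hahn_banach_closed_point
    (hconv.is_linear_image ρ.toLinearMap.isLinear) (hK.image ρ.continuous).isClosed hnot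
  -- A weak* continuous functional on the dual of `V` is evaluation at a point of `V`.
  obtain ⟨v, hv⟩ := LinearMap.dualEmbedding_surjective (topDualPairing ℝ V) g
  have hgv : ∀ z, g (ρ z) = z (v : X) := fun z => by rw [← hv]; rfl
  exact ⟨v, v.2, r, fun z hz => hgv z ▸ hg _ ⟨z, hz, rfl⟩, hgv x ▸ hgx⟩

/-- In an Asplund space there is a family of functionals, indexed by points of the space and
rational numbers, such that the functionals attached to a set `C` approximate, uniformly on the
unit ball of any subspace contained in the closure of `C`, every functional of norm at most `N`. -/
theorem IsAsplund.exists_approximating_family {X : Type*} [NormedAddCommGroup X]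
    [NormedSpace ℝ X] (hX : IsAsplund X) (N : ℝ) {ε : ℝ} (hε : 0 < ε) :
    ∃ y : X → ℚ → StrongDual ℝ X, ∀ (V : Submodule ℝ X) (C : Set X), (V : Set X) ⊆ closure C →
      ∀ x : StrongDual ℝ X, ‖x‖ ≤ N → ∃ c ∈ C, ∃ q, ‖dualRestrict V (x - y c q)‖ ≤ ε := by
  have hsl : ∀ K : Set (WeakDual ℝ X), ∃ (x : X) (r : ℝ) (d : StrongDual ℝ X),
      K.Nonempty → (∀ k ∈ K, ‖WeakDual.toStrongDual k‖ ≤ N) → (∃ k ∈ K, r < k x) ∧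
      ∀ k ∈ K, r < k x → ‖WeakDual.toStrongDual k - d‖ ≤ ε := by
    intro K
    by_cases h : K.Nonempty ∧ ∀ k ∈ K, ‖WeakDual.toStrongDual k‖ ≤ N
    · obtain ⟨x, r, d, hd⟩ := hX.exists_small_slice h.1 h.2 hε
      exact ⟨x, r, d, fun _ _ => hd⟩
    · exact ⟨0, 0, 0, fun h1 h2 => absurd ⟨h1, h2⟩ h⟩
  choose p r d hpr using hsl
  set B : Set (WeakDual ℝ X) := WeakDual.toStrongDual ⁻¹' Metric.closedBall 0 N with hBdef
  have hBc : IsCompact B := WeakDual.isCompact_closedBall ..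
  have hBN : ∀ k, k ∈ B ↔ ‖WeakDual.toStrongDual k‖ ≤ N := fun k => by simp [hBdef]
  have hBconv : Convex ℝ B :=
    (convex_closedBall (0 : StrongDual ℝ X) N).is_linear_preimage
      (WeakDual.toStrongDual (𝕜 := ℝ) (E := X)).toLinearMap.isLinear
  set cut : Set (WeakDual ℝ X) → Set (WeakDual ℝ X) := fun K => {k ∈ K | k (p K) ≤ r K}
    with hcutdef
  set F : Ordinal → Set (WeakDual ℝ X) := iterCut B cut with hF
  have hcutF : ∀ K ⊆ B, (IsClosed K ∧ Convex ℝ K) → IsClosed (cut K) ∧ Convex ℝ (cut K) := by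
    intro K _ h
    refine ⟨h.1.inter (isClosed_le (WeakDual.eval_continuous _) continuous_const),
      h.2.inter ?_⟩
    exact convex_halfSpace_le (f := fun k : WeakDual ℝ X => k (p K))
      ⟨fun _ _ => rfl, fun _ _ => rfl⟩ _
  have hFcc : ∀ a, IsClosed (F a) ∧ Convex ℝ (F a) := iterCut_induction hcutF fun S hS =>
    ⟨hBc.isClosed.inter (isClosed_sInter fun s hs => (hS s hs).1),
      hBconv.inter (convex_sInter fun s hs => (hS s hs).2)⟩
  have hFB : ∀ a, F a ⊆ B := iterCut_subset B cut
  have hcutc : ∀ a, IsCompact (cut (F a)) := fun a =>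
    hBc.of_isClosed_subset (hcutF _ (hFB a) (hFcc a)).1 ((sep_subset _ _).trans (hFB a))
  obtain ⟨aemp, haemp⟩ : ∃ a, F a = ∅ := exists_iterCut_eq_empty B cut fun K hK hne => by
    obtain ⟨⟨k, hk, hlt⟩, -⟩ := hpr K hne fun k hk => (hBN k).1 (hK hk)
    exact ⟨sep_subset _ _, fun h => (h hk).2.not_gt hlt⟩
  -- The pair `(c, q)` encodes the first stage whose remainder lies below `q` at `c`; the centre of
  -- the slice removed there is chosen.
  refine ⟨fun c q => d (F (sInf {a | ∀ z ∈ cut (F a), z c < q})), fun V C hVC x hxN => ?_⟩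
  set x' : WeakDual ℝ X := StrongDual.toWeakDual x with hx'
  set S : Set Ordinal := {a | ∀ z ∈ cut (F a), ∃ v ∈ V, z v ≠ x v} with hS
  have hSne : S.Nonempty := ⟨aemp, fun z hz => by rw [haemp] at hz; exact absurd hz.1 (by simp)⟩
  set a₀ := sInf S with ha₀
  have ha₀S : a₀ ∈ S := csInf_mem hSne
  have hlt : ∀ b < a₀, ∃ z ∈ cut (F b), ∀ v ∈ V, z v = x v := by
    intro b hb
    have := notMem_of_lt_csInf' hb
    simp only [hS, mem_ofPred_eq] at this
    push Not at this
    exact this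
  have hagree : IsClosed {z : WeakDual ℝ X | ∀ v ∈ V, z v = x v} := by
    simp only [ofPred_forall]
    exact isClosed_iInter fun v => isClosed_iInter fun _ =>
      isClosed_eq (WeakDual.eval_continuous _) continuous_const
  -- Before stage `a₀` functionals agreeing with `x` on `V` survive each cut; compactness gives one
  -- surviving all of them. At stage zero `x` itself serves.
  obtain ⟨z₀, hz₀F, hz₀⟩ : ∃ z ∈ F a₀, ∀ v ∈ V, z v = x v := by
    by_cases h0 : (Iio a₀).Nonempty
    · have : Nonempty (Iio a₀) := h0.to_subtype
      obtain ⟨z, hz⟩ := IsCompact.nonempty_iInter_of_directed_nonempty_isCompact_isClosed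
        (fun b : Iio a₀ => cut (F b) ∩ {z : WeakDual ℝ X | ∀ v ∈ V, z v = x v})
        (by
          refine directed_of_isDirected_le fun b c hbc => ?_
          refine inter_subset_inter_left _ ?_
          rcases hbc.eq_or_lt with rfl | h
          · exact subset_rfl
          · exact (sep_subset _ _).trans (iterCut_subset_cut B cut h))
        (fun b => (hlt b b.2).imp fun z hz => hz)
        (fun b => (hcutc b).inter_right hagree)
        (fun b => ((hcutc b).inter_right hagree).isClosed)
      rw [mem_iInter] at hz
      exact ⟨z, mem_iterCut.2 ⟨hFB _ (hz ⟨_, h0.choose_spec⟩).1.1, fun b hb => (hz ⟨b, hb⟩).1⟩,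
        (hz ⟨_, h0.choose_spec⟩).2⟩
    · refine ⟨x', mem_iterCut.2 ⟨(hBN _).2 hxN, fun b hb => absurd ⟨b, hb⟩ h0⟩, fun _ _ => rfl⟩
  -- By the choice of `a₀`, `z₀` does not survive the next cut, so it lies in the small slice.
  have hd : ‖WeakDual.toStrongDual z₀ - d (F a₀)‖ ≤ ε := by
    refine (hpr (F a₀) ⟨z₀, hz₀F⟩ fun k hk => (hBN k).1 (hFB _ hk)).2 _ hz₀F ?_
    by_contra h
    obtain ⟨v, hv, hne⟩ := ha₀S z₀ ⟨hz₀F, not_lt.1 h⟩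
    exact hne (hz₀ v hv)
  obtain ⟨v, hv, u, hu, hux⟩ := WeakDual.exists_separating_mem (hcutc a₀)
    (hcutF _ (hFB _) (hFcc _)).2 V x' ha₀S
  obtain ⟨q, huq, hqx⟩ := exists_rat_btwn hux
  -- The margin `δ` on both sides of `q` allows `v` to be replaced by a nearby `c`, uniformly over
  -- the ball.
  obtain ⟨δ, hδ, hδu, hδx⟩ : ∃ δ : ℝ, 0 < δ ∧ u + δ ≤ q ∧ q + δ ≤ x v :=
    ⟨min (q - u) (x v - q), lt_min (sub_pos.2 huq) (sub_pos.2 hqx),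
      by linarith [min_le_left ((q : ℝ) - u) (x v - q)],
      by linarith [min_le_right ((q : ℝ) - u) (x v - q)]⟩
  obtain ⟨c, hc, hcv⟩ := Metric.mem_closure_iff.1 (hVC hv) (δ / (|N| + 1)) (by positivity)
  have hclose : ∀ z ∈ B, |z c - z v| < δ := by
    intro z hz
    have e : z c - z v = WeakDual.toStrongDual z (c - v) :=
      ((WeakDual.toStrongDual z).map_sub c v).symm
    rw [e, ← Real.norm_eq_abs]
    rw [dist_comm, dist_eq_norm, lt_div_iff₀ (by positivity)] at hcv
    have h1 := (WeakDual.toStrongDual z).le_opNorm (c - v)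
    have h2 : ‖WeakDual.toStrongDual z‖ ≤ |N| + 1 := by
      linarith [(hBN z).1 hz, le_abs_self N]
    have h3 := mul_le_mul_of_nonneg_right h2 (norm_nonneg (c - v))
    linarith
  refine ⟨c, hc, q, ?_⟩
  have hmem : a₀ ∈ {a | ∀ z ∈ cut (F a), z c < q} := fun z hz => by
    have h1 := abs_lt.1 (hclose z (hFB _ hz.1))
    have h2 := hu z hz
    linarith
  -- An earlier stage cannot qualify: its remainder contains a functional equal to `x` on `V`, whose
  -- value at `c` exceeds `x v - δ ≥ q`.
  have hinf : sInf {a | ∀ z ∈ cut (F a), z c < q} = a₀ := by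
    refine le_antisymm (csInf_le' hmem) (le_of_not_gt fun h => ?_)
    obtain ⟨z, hz, hzx⟩ := hlt _ h
    have h1 := abs_lt.1 (hclose z (hFB _ hz.1))
    have h2 : z c < q := csInf_mem (s := {a | ∀ z ∈ cut (F a), z c < q}) ⟨_, hmem⟩ z hz
    have h3 := hzx v hv
    linarith
  have hres : dualRestrict V (x - d (F a₀)) =
      dualRestrict V (WeakDual.toStrongDual z₀ - d (F a₀)) := by
    ext w
    have : z₀ (w : X) = x w := hz₀ w w.2
    simp [dualRestrict, this]
  simp only [hinf, hres]
  refine ContinuousLinearMap.opNorm_le_bound _ hε.le fun w => ?_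
  exact (ContinuousLinearMap.le_opNorm (WeakDual.toStrongDual z₀ - d (F a₀)) (w : X)).trans
    (mul_le_mul_of_nonneg_right hd (norm_nonneg _))

/-! ### Countable σ-continuous generators -/

/-- To every subset `V` of a metric space one can attach a set `C V` of points approximating `V`,
countable when `V` is separable, in a monotone and `σ`-continuous way. -/
theorem exists_monotone_countable_approximation (X : Type*) [PseudoMetricSpace X] :
    ∃ C : Set X → Set X, Monotone C ∧
      (∀ V, TopologicalSpace.IsSeparable V → (C V).Countable) ∧ (∀ V, V ⊆ closure (C V)) ∧
      ∀ u : ℕ → Set X, C (closure (⋃ n, u n)) ⊆ ⋃ n, C (u n) := by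
  have href : ∀ n : ℕ, ∃ U : X → Set X, (∀ x, IsOpen (U x)) ∧ ⋃ x, U x = univ ∧
      LocallyFinite U ∧ ∀ x, U x ⊆ Metric.ball x (1 / (n + 1 : ℝ)) := fun n =>
    precise_refinement _ (fun _ => Metric.isOpen_ball) (iUnion_eq_univ_iff.2 fun x =>
      ⟨x, Metric.mem_ball_self (by positivity)⟩)
  choose U hopen hcov hfin hsub using href
  -- Openness makes meeting the closure of a set the same as meeting the set; local finiteness then
  -- gives countability for separable `V`.
  refine ⟨fun V => {x | ∃ n, (U n x ∩ V).Nonempty}, ?_, ?_, ?_, ?_⟩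
  · rintro V W hVW x ⟨n, h⟩
    exact ⟨n, h.mono (inter_subset_inter_right _ hVW)⟩
  · rintro V ⟨D, hD, hVD⟩
    refine (hD.biUnion fun d _ => countable_iUnion fun n =>
      ((hfin n).point_finite d).countable).mono ?_
    rintro x ⟨n, z, hzU, hzV⟩
    obtain ⟨d, hdU, hd⟩ := mem_closure_iff.1 (hVD hzV) _ (hopen n x) hzU
    exact mem_biUnion hd (mem_iUnion.2 ⟨n, hdU⟩)
  · intro V v hv
    refine Metric.mem_closure_iff.2 fun ε hε => ?_
    obtain ⟨n, hn⟩ := exists_nat_one_div_lt hε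
    obtain ⟨x, hx⟩ := iUnion_eq_univ_iff.1 (hcov n) v
    exact ⟨x, ⟨n, v, hx, hv⟩, (Metric.mem_ball.1 (hsub n x hx)).trans hn⟩
  · rintro u x ⟨n, z, hzU, hz⟩
    obtain ⟨w, hwU, hw⟩ := mem_closure_iff.1 hz _ (hopen n x) hzU
    obtain ⟨k, hk⟩ := mem_iUnion.1 hw
    exact mem_iUnion.2 ⟨k, n, w, hwU, hk⟩

/-- A `σ`-continuous assignment, to subsets of `X`, of approximating sets of points and of
functionals, such that the functionals attached to a subspace `V` are dense in `V*`. -/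
structure DualGenerator (X : Type*) [NormedAddCommGroup X] [NormedSpace ℝ X] where
  /-- The points attached to a set. -/
  pts : Set X → Set X
  /-- The functionals attached to a set. -/
  fns : Set X → Set (StrongDual ℝ X)
  pts_mono : Monotone pts
  fns_mono : Monotone fns
  countable_pts : ∀ V, TopologicalSpace.IsSeparable V → (pts V).Countable
  countable_fns : ∀ V, TopologicalSpace.IsSeparable V → (fns V).Countable
  subset_closure_pts : ∀ V, V ⊆ closure (pts V)
  pts_closure_iUnion : ∀ u : ℕ → Set X, pts (closure (⋃ n, u n)) ⊆ ⋃ n, pts (u n)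
  fns_closure_iUnion : ∀ u : ℕ → Set X, fns (closure (⋃ n, u n)) ⊆ ⋃ n, fns (u n)
  exists_approx : ∀ (V : Submodule ℝ X) (x : StrongDual ℝ X) (ε : ℝ), 0 < ε →
    ∃ γ ∈ fns V, ‖dualRestrict V (x - γ)‖ ≤ ε

/-- Asplund spaces have a dual generator. -/
theorem IsAsplund.nonempty_dualGenerator {X : Type*} [NormedAddCommGroup X] [NormedSpace ℝ X]
    (hX : IsAsplund X) : Nonempty (DualGenerator X) := by
  obtain ⟨C, hmono, hcount, hcl, hcont⟩ := exists_monotone_countable_approximation X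
  choose y hy using fun m : ℕ =>
    hX.exists_approximating_family (m : ℝ) (Nat.one_div_pos_of_nat (α := ℝ) (n := m))
  refine ⟨⟨C, fun V => ⋃ c ∈ C V, range fun i : ℕ × ℚ => y i.1 c i.2, hmono,
    fun V W h => biUnion_subset_biUnion_left (hmono h), hcount,
    fun V hV => (hcount V hV).biUnion fun _ _ => countable_range _, hcl, hcont, ?_, ?_⟩⟩
  · intro u γ hγ
    obtain ⟨c, hc, hγ⟩ := mem_iUnion₂.1 hγ
    obtain ⟨n, hn⟩ := mem_iUnion.1 (hcont u hc)
    exact mem_iUnion.2 ⟨n, mem_biUnion hn hγ⟩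
  · intro V x ε hε
    obtain ⟨n, hn⟩ := exists_nat_one_div_lt hε
    obtain ⟨k, hk⟩ := exists_nat_ge ‖x‖
    obtain ⟨c, hc, q, h⟩ := hy (max n k) V (C V) (hcl V) x
      (hk.trans (by exact_mod_cast le_max_right n k))
    -- The index `max n k` serves both the precision `1 / (n + 1)` and the norm bound `k`.
    refine ⟨_, mem_biUnion hc ⟨(max n k, q), rfl⟩, h.trans (le_trans ?_ hn.le)⟩
    exact Nat.one_div_le_one_div (le_max_left n k)

/-! ### Norming points and witnesses -/

theorem continuous_dualRestrict {X : Type*} [NormedAddCommGroup X] [NormedSpace ℝ X]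
    (V : Submodule ℝ X) : Continuous (dualRestrict V) :=
  (ContinuousLinearMap.precomp ℝ V.subtypeL).continuous

theorem norm_dualRestrict_le {X : Type*} [NormedAddCommGroup X] [NormedSpace ℝ X]
    (V : Submodule ℝ X) (y : StrongDual ℝ X) : ‖dualRestrict V y‖ ≤ ‖y‖ :=
  ContinuousLinearMap.opNorm_le_bound _ (norm_nonneg _) fun w => y.le_opNorm (w : X)

theorem norm_dualRestrict_mono {X : Type*} [NormedAddCommGroup X] [NormedSpace ℝ X]
    {V W : Submodule ℝ X} (h : V ≤ W) (y : StrongDual ℝ X) :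
    ‖dualRestrict V y‖ ≤ ‖dualRestrict W y‖ :=
  ContinuousLinearMap.opNorm_le_bound _ (norm_nonneg (dualRestrict W y)) fun w =>
    (dualRestrict W y).le_opNorm ⟨w, h w.2⟩

/-- A separable set of functionals is normed by a countable set of points. -/
theorem exists_countable_norming {X : Type*} [NormedAddCommGroup X] [NormedSpace ℝ X]
    {S : Set (StrongDual ℝ X)} (hS : TopologicalSpace.IsSeparable S) :
    ∃ T : Set X, T.Countable ∧ ∀ W : Submodule ℝ X, T ⊆ W → ∀ y ∈ S,
      ‖y‖ ≤ ‖dualRestrict W y‖ := by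
  obtain ⟨D, hD, hSD⟩ := hS
  have hex : ∀ (y : StrongDual ℝ X) (q : ℚ), ∃ x : X, (q : ℝ) < ‖y‖ → ‖x‖ < 1 ∧ q < ‖y x‖ := by
    intro y q
    by_cases h : (q : ℝ) < ‖y‖
    · obtain ⟨x, hx⟩ := y.exists_lt_apply_of_lt_opNorm h
      exact ⟨x, fun _ => hx⟩
    · exact ⟨0, fun h' => absurd h' h⟩
  choose t ht using hex
  refine ⟨⋃ y ∈ D, range (t y), hD.biUnion fun _ _ => countable_range _, fun W hW => ?_⟩
  have hcl : IsClosed {y : StrongDual ℝ X | ‖y‖ ≤ ‖dualRestrict W y‖} :=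
    isClosed_le continuous_norm (Continuous.norm (f := dualRestrict W) (continuous_dualRestrict W))
  refine fun y hy => hcl.closure_subset_iff.2 (fun y hy => ?_) (hSD hy)
  change ‖y‖ ≤ ‖dualRestrict W y‖
  by_contra! hlt
  obtain ⟨q, hqW, hq⟩ := exists_rat_btwn hlt
  obtain ⟨h1, h2⟩ := ht y q hq
  have h3 := (dualRestrict W y).le_opNorm ⟨t y q, hW (mem_biUnion hy ⟨q, rfl⟩)⟩
  have h4 : ‖dualRestrict W y‖ * ‖t y q‖ ≤ ‖dualRestrict W y‖ :=
    mul_le_of_le_one_right (norm_nonneg (dualRestrict W y)) h1.le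
  exact lt_irrefl _ (hqW.trans (h2.trans_le (h3.trans h4)))

/-- `W` contains witnesses for the norms of the functionals in the span of `S` and of those attached
to `V`, and for the relevant values of `f` near the points attached to `V`. -/
structure DualGenerator.IsStep {X : Type*} [NormedAddCommGroup X] [NormedSpace ℝ X]
    (G : DualGenerator X) (f : X → EReal) (S : Set (StrongDual ℝ X)) (V W : Submodule ℝ X) :
    Prop where
  norm_le : ∀ y ∈ Submodule.span ℝ (S ∪ G.fns V), ‖y‖ ≤ ‖dualRestrict W y‖
  exists_mem : ∀ c ∈ G.pts V, ∀ γ ∈ G.fns V, ∀ s t q : ℚ,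
    (∃ x, (s : ℝ) < ‖x - c‖ ∧ ‖x - c‖ < t ∧ f x < ((q + γ x : ℝ) : EReal)) →
    ∃ x ∈ W, (s : ℝ) < ‖x - c‖ ∧ ‖x - c‖ < t ∧ f x < ((q + γ x : ℝ) : EReal)

namespace DualGenerator

variable {X : Type*} [NormedAddCommGroup X] [NormedSpace ℝ X] (G : DualGenerator X)
  {f : X → EReal} {S S' : Set (StrongDual ℝ X)}

theorem IsStep.mono {G : DualGenerator X} {V W W' : Submodule ℝ X} (h : G.IsStep f S V W)
    (hS : S' ⊆ S) (hW : W ≤ W') : G.IsStep f S' V W' where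
  norm_le y hy := (h.norm_le y (Submodule.span_mono (union_subset_union_left _ hS) hy)).trans
    (norm_dualRestrict_mono hW y)
  exists_mem c hc γ hγ s t q hx :=
    (h.exists_mem c hc γ hγ s t q hx).imp fun _ hx' => ⟨hW hx'.1, hx'.2⟩

theorem exists_isStep (f : X → EReal) (hS : TopologicalSpace.IsSeparable S) (V : SepSubspace X) :
    ∃ W : SepSubspace X, V ≤ W ∧ G.IsStep f S V.1 W.1 := by
  have hpts := G.countable_pts V.1 V.2.2
  have hfns := G.countable_fns V.1 V.2.2
  obtain ⟨T, hT, hTn⟩ := exists_countable_norming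
    (S := (Submodule.span ℝ (S ∪ G.fns V.1) : Set (StrongDual ℝ X)))
    (hS.union hfns.isSeparable).span
  have hex : ∀ (c : X) (γ : StrongDual ℝ X) (i : ℚ × ℚ × ℚ), ∃ z : X,
      (∃ x, (i.1 : ℝ) < ‖x - c‖ ∧ ‖x - c‖ < i.2.1 ∧ f x < ((i.2.2 + γ x : ℝ) : EReal)) →
      (i.1 : ℝ) < ‖z - c‖ ∧ ‖z - c‖ < i.2.1 ∧ f z < ((i.2.2 + γ z : ℝ) : EReal) := by
    intro c γ i
    by_cases h : ∃ x, (i.1 : ℝ) < ‖x - c‖ ∧ ‖x - c‖ < i.2.1 ∧ f x < ((i.2.2 + γ x : ℝ) : EReal)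
    · exact ⟨h.choose, fun _ => h.choose_spec⟩
    · exact ⟨0, fun h' => absurd h' h⟩
  choose z hz using hex
  set A : Set X := ⋃ c ∈ G.pts V.1, ⋃ γ ∈ G.fns V.1, range (z c γ) with hA
  have hAc : A.Countable :=
    hpts.biUnion fun _ _ => hfns.biUnion fun _ _ => countable_range _
  refine ⟨⟨(Submodule.span ℝ (V.1 ∪ (T ∪ A))).topologicalClosure,
    Submodule.isClosed_topologicalClosure _, ?_⟩, ?_, ?_, ?_⟩
  · exact (V.2.2.union (hT.union hAc).isSeparable).span.closure
  · exact (subset_union_left.trans Submodule.subset_span).trans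
      (Submodule.le_topologicalClosure _)
  · exact hTn _ (((subset_union_left.trans subset_union_right).trans
      Submodule.subset_span).trans (Submodule.le_topologicalClosure _))
  · intro c hc γ hγ s t q hx
    refine ⟨z c γ (s, t, q), Submodule.le_topologicalClosure _ (Submodule.subset_span ?_),
      hz c γ (s, t, q) hx⟩
    exact Or.inr (Or.inr (mem_biUnion hc (mem_biUnion hγ ⟨_, rfl⟩)))

end DualGenerator

/-! ### Limits of increasing sequences -/

/-- The closure of the union of an increasing sequence of separable closed subspaces. -/
noncomputable def SepSubspace.limit {Z : Type*} [NormedAddCommGroup Z] [NormedSpace ℝ Z]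
    (u : ℕ → SepSubspace Z) : SepSubspace Z :=
  ⟨(Submodule.span ℝ (⋃ n, ((u n).1 : Set Z))).topologicalClosure,
    Submodule.isClosed_topologicalClosure _,
    (TopologicalSpace.IsSeparable.iUnion fun n => (u n).2.2).span.closure⟩

namespace SepSubspace

variable {Z : Type*} [NormedAddCommGroup Z] [NormedSpace ℝ Z] {u : ℕ → SepSubspace Z}

theorem le_limit (u : ℕ → SepSubspace Z) (n : ℕ) : u n ≤ limit u :=
  ((subset_iUnion (fun n => ((u n).1 : Set Z)) n).trans Submodule.subset_span).trans
    (Submodule.le_topologicalClosure _)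

theorem limit_le {W : Submodule ℝ Z} (hW : IsClosed (W : Set Z)) (h : ∀ n, (u n).1 ≤ W) :
    (limit u).1 ≤ W :=
  Submodule.topologicalClosure_minimal _ (Submodule.span_le.2 (iUnion_subset h)) hW

theorem coe_limit (hu : Monotone u) :
    ((limit u).1 : Set Z) = closure (⋃ n, ((u n).1 : Set Z)) := by
  have hdir : Directed (· ≤ ·) fun n => (u n).1 :=
    (show Monotone fun n => (u n).1 from hu).directed_le
  have : (Submodule.span ℝ (⋃ n, ((u n).1 : Set Z)) : Set Z) = ⋃ n, ((u n).1 : Set Z) := by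
    rw [Submodule.span_iUnion]
    simp only [Submodule.span_eq]
    exact Submodule.coe_iSup_of_directed _ hdir
  rw [limit, Submodule.topologicalClosure_coe, this]

end SepSubspace

namespace DualGenerator

variable {X : Type*} [NormedAddCommGroup X] [NormedSpace ℝ X] (G : DualGenerator X)
  {f : X → EReal} {S S' : Set (StrongDual ℝ X)}

/-- By σ-continuity the data of the limit already occur at finite stages, each of which has its
witnesses in the next subspace; the spans are directed, so this covers linear combinations too. -/
theorem isStep_limit {u : ℕ → SepSubspace X} (hu : Monotone u)
    (h : ∀ n, G.IsStep f S (u n).1 (u (n + 1)).1) :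
    G.IsStep f S (SepSubspace.limit u).1 (SepSubspace.limit u).1 := by
  have hmono : Monotone fun n => ((u n).1 : Set X) := hu
  have hp : G.pts (SepSubspace.limit u).1 ⊆ ⋃ n, G.pts (u n).1 := by
    rw [SepSubspace.coe_limit hu]; exact G.pts_closure_iUnion _
  have hf : G.fns (SepSubspace.limit u).1 ⊆ ⋃ n, G.fns (u n).1 := by
    rw [SepSubspace.coe_limit hu]; exact G.fns_closure_iUnion _
  have hstep : ∀ n, G.IsStep f S (u n).1 (SepSubspace.limit u).1 := fun n =>
    (h n).mono subset_rfl (SepSubspace.le_limit u (n + 1))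
  refine ⟨fun y hy => ?_, fun c hc γ hγ s t q hx => ?_⟩
  · have hdir : Directed (· ≤ ·) fun n => Submodule.span ℝ (S ∪ G.fns (u n).1) :=
      Monotone.directed_le fun m n hmn => Submodule.span_mono
        (union_subset_union_right _ (G.fns_mono (hmono hmn)))
    have hy' : y ∈ ⨆ n, Submodule.span ℝ (S ∪ G.fns (u n).1) := by
      rw [← Submodule.span_iUnion, ← union_iUnion]
      exact Submodule.span_mono (union_subset_union_right _ hf) hy
    obtain ⟨n, hn⟩ := (Submodule.mem_iSup_of_directed _ hdir).1 hy'
    exact (hstep n).norm_le y hn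
  · obtain ⟨m, hm⟩ := mem_iUnion.1 (hp hc)
    obtain ⟨n, hn⟩ := mem_iUnion.1 (hf hγ)
    exact (hstep (max m n)).exists_mem c (G.pts_mono (hmono (le_max_left m n)) hm) γ
      (G.fns_mono (hmono (le_max_right m n)) hn) s t q hx

theorem exists_isStep_self (f : X → EReal) (hS : TopologicalSpace.IsSeparable S)
    (V : SepSubspace X) : ∃ W : SepSubspace X, V ≤ W ∧ G.IsStep f S W.1 W.1 := by
  choose next hle hnext using G.exists_isStep f hS
  set u : ℕ → SepSubspace X := fun n => next^[n] V with hu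
  have hsucc : ∀ n, u (n + 1) = next (u n) := fun n => Function.iterate_succ_apply' next n V
  refine ⟨SepSubspace.limit u, SepSubspace.le_limit u 0,
    G.isStep_limit (monotone_nat_of_le_succ fun n => ?_) fun n => ?_⟩
  · rw [hsucc]; exact hle _
  · rw [hsucc]; exact hnext _

/-! ### The dual side of a rectangle -/

/-- The separable closed subspace of the dual generated by the functionals attached to `V`. -/
noncomputable def dual (V : SepSubspace X) : SepSubspace (StrongDual ℝ X) :=
  ⟨(Submodule.span ℝ (G.fns V.1)).topologicalClosure, Submodule.isClosed_topologicalClosure _,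
    (G.countable_fns V.1 V.2.2).isSeparable.span.closure⟩

theorem dual_mono : Monotone G.dual := fun _ _ h =>
  Submodule.topologicalClosure_mono (Submodule.span_mono (G.fns_mono h))

theorem fns_subset_dual (V : SepSubspace X) : G.fns V.1 ⊆ (G.dual V).1 :=
  Submodule.subset_span.trans (Submodule.le_topologicalClosure _)

theorem dual_limit_le {u : ℕ → SepSubspace X} (hu : Monotone u) {W : Submodule ℝ (StrongDual ℝ X)}
    (hW : IsClosed (W : Set (StrongDual ℝ X))) (h : ∀ n, (G.dual (u n)).1 ≤ W) :
    (G.dual (SepSubspace.limit u)).1 ≤ W := by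
  refine Submodule.topologicalClosure_minimal _ (Submodule.span_le.2 ?_) hW
  rw [SepSubspace.coe_limit hu]
  exact (G.fns_closure_iUnion _).trans
    (iUnion_subset fun n => (G.fns_subset_dual (u n)).trans (h n))

theorem IsStep.norm_dualRestrict {G : DualGenerator X} {V : SepSubspace X}
    (h : G.IsStep f S V.1 V.1) {y : StrongDual ℝ X} (hy : y ∈ (G.dual V).1) :
    ‖dualRestrict V.1 y‖ = ‖y‖ := by
  refine le_antisymm (norm_dualRestrict_le _ _) ?_
  have hcl : IsClosed {y : StrongDual ℝ X | ‖y‖ ≤ ‖dualRestrict V.1 y‖} :=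
    isClosed_le continuous_norm
      (Continuous.norm (f := dualRestrict V.1) (continuous_dualRestrict V.1))
  exact hcl.closure_subset_iff.2
    (fun z hz => h.norm_le z (Submodule.span_mono subset_union_right hz)) hy

theorem mem_closure_fns {G : DualGenerator X} {V : SepSubspace X}
    {y : StrongDual ℝ X}
    (h : ∀ γ ∈ G.fns V.1, ‖y - γ‖ ≤ ‖dualRestrict V.1 (y - γ)‖) : y ∈ closure (G.fns V.1) := by
  refine Metric.mem_closure_iff.2 fun ε hε => ?_
  obtain ⟨γ, hγ, hle⟩ := G.exists_approx V.1 y (ε / 2) (half_pos hε)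
  exact ⟨γ, hγ, by rw [dist_eq_norm]; linarith [h γ hγ]⟩

/-- For `y ∈ S`, `V` norms every difference `y - γ`, so approximation on `V` is approximation in
norm. This absorbs prescribed functionals in the cofinality proof. -/
theorem IsStep.subset_dual {G : DualGenerator X} {V : SepSubspace X} (h : G.IsStep f S V.1 V.1) :
    S ⊆ (G.dual V).1 := fun _ hy =>
  closure_minimal (G.fns_subset_dual V) (G.dual V).2.1 (mem_closure_fns fun _ hγ =>
    h.norm_le _ (sub_mem (Submodule.subset_span (Or.inl hy)) (Submodule.subset_span (Or.inr hγ))))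

theorem IsStep.isometry {G : DualGenerator X} {V : SepSubspace X} (h : G.IsStep f S V.1 V.1) :
    Isometry fun y : (G.dual V).1 => dualRestrict V.1 (y : StrongDual ℝ X) :=
  Isometry.of_dist_eq fun y z => by
    have key := h.norm_dualRestrict (sub_mem y.2 z.2)
    rw [Subtype.dist_eq, dist_eq_norm (y : StrongDual ℝ X) z, ← key]
    exact dist_eq_norm (dualRestrict V.1 (y : StrongDual ℝ X)) (dualRestrict V.1 z)

/-- The range is dense by approximation of Hahn–Banach extensions, and closed as an isometric image
of a complete space. -/
theorem IsStep.surjective {G : DualGenerator X} {V : SepSubspace X} (h : G.IsStep f S V.1 V.1) :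
    Function.Surjective fun y : (G.dual V).1 => dualRestrict V.1 (y : StrongDual ℝ X) := by
  have : CompleteSpace (G.dual V).1 := (G.dual V).2.1.completeSpace_coe
  have hcl := h.isometry.isClosedEmbedding.isClosed_range
  intro v
  obtain ⟨x, hx, -⟩ := exists_extension_norm_eq V.1 v
  have hxv : dualRestrict V.1 x = v := ContinuousLinearMap.ext hx
  refine hcl.closure_subset (Metric.mem_closure_iff.2 fun ε hε => ?_)
  obtain ⟨γ, hγ, hle⟩ := G.exists_approx V.1 x (ε / 2) (half_pos hε)
  refine ⟨_, ⟨⟨γ, G.fns_subset_dual V hγ⟩, rfl⟩, ?_⟩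
  rw [← hxv, dist_eq_norm]
  exact hle.trans_lt (half_lt_self hε)

end DualGenerator

/-! ### Fréchet subdifferentials -/

theorem EReal.coe_neg_lt_sub_sub_iff (b : EReal) (a c e : ℝ) :
    ((-e : ℝ) : EReal) < b - a - c ↔ ((a + c - e : ℝ) : EReal) < b := by
  induction b with
  | bot => simp
  | top => exact iff_of_true (EReal.coe_lt_top _) (EReal.coe_lt_top _)
  | coe b =>
    norm_cast
    constructor <;> intro h <;> linarith

/-- Characterization of the Fréchet subdifferential of a function with values in `(-∞, +∞]` in
terms of real numbers. -/
theorem mem_frechetSubdifferential_iff {E : Type*} [NormedAddCommGroup E] [NormedSpace ℝ E]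
    {f : E → EReal} {x : E} (hx : f x ≠ ⊥) {xs : StrongDual ℝ E} :
    xs ∈ frechetSubdifferential f x ↔ ∃ a : ℝ, f x = a ∧ ∀ ε : ℝ, 0 < ε → ∃ δ : ℝ, 0 < δ ∧
      ∀ h : E, 0 < ‖h‖ → ‖h‖ < δ → ((a + xs h - ε * ‖h‖ : ℝ) : EReal) < f (x + h) := by
  constructor
  · rintro ⟨htop, H⟩
    refine ⟨(f x).toReal, (EReal.coe_toReal htop.ne hx).symm, fun ε hε => ?_⟩
    obtain ⟨δ, hδ, h⟩ := H ε hε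
    refine ⟨δ, hδ, fun v h0 h1 => ?_⟩
    rw [← EReal.coe_neg_lt_sub_sub_iff, EReal.coe_toReal htop.ne hx]
    exact h v h0 h1
  · rintro ⟨a, ha, H⟩
    refine ⟨ha ▸ EReal.coe_lt_top a, fun ε hε => ?_⟩
    obtain ⟨δ, hδ, h⟩ := H ε hε
    refine ⟨δ, hδ, fun v h0 h1 => ?_⟩
    rw [ha, EReal.coe_neg_lt_sub_sub_iff]
    exact h v h0 h1

theorem dualRestrict_mem_frechetSubdifferential {X : Type*} [NormedAddCommGroup X]
    [NormedSpace ℝ X] {f : X → EReal} (V : Submodule ℝ X) {v : V} {xs : StrongDual ℝ X}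
    (h : xs ∈ frechetSubdifferential f (v : X)) :
    dualRestrict V xs ∈ frechetSubdifferential (fun w : V => f (w : X)) v :=
  ⟨h.1, fun ε hε => (h.2 ε hε).imp fun _ hδ => ⟨hδ.1, fun w h0 h1 => hδ.2 (w : X) h0 h1⟩⟩

namespace DualGenerator

variable {X : Type*} [NormedAddCommGroup X] [NormedSpace ℝ X] {G : DualGenerator X}
  {f : X → EReal} {S : Set (StrongDual ℝ X)}

/-- A violation of the subgradient inequality at `v + k` is moved into `V`: the witness property
gives a point of `V` at nearly the same distance from `v` with a comparable violation. -/
theorem IsStep.mem_frechetSubdifferential {V : SepSubspace X} (hV : G.IsStep f S V.1 V.1)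
    (hf : ∀ x, f x ≠ ⊥) {y : StrongDual ℝ X} (hy : y ∈ (G.dual V).1) {v : V.1}
    (h : dualRestrict V.1 y ∈ frechetSubdifferential (fun w : V.1 => f (w : X)) v) :
    y ∈ frechetSubdifferential f (v : X) := by
  obtain ⟨a, ha, H⟩ := (mem_frechetSubdifferential_iff (f := fun w : V.1 => f (w : X))
    (hf v)).1 h
  refine (mem_frechetSubdifferential_iff (hf _)).2 ⟨a, ha, fun ε hε => ?_⟩
  obtain ⟨δ, hδ, hδV⟩ := H (ε / 2) (half_pos hε)
  refine ⟨δ, hδ, fun k hk0 hkδ => ?_⟩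
  by_contra! hle
  set ρ := ‖k‖ with hρ
  -- Replacing `v` by `c` and rounding the radii shifts distances by less than `3 * η`, so the
  -- witness stays within `δ` of `v`, at distance between `ρ / 2` and `3 * ρ / 2`.
  obtain ⟨η, hη, hηρ, hηδ⟩ : ∃ η : ℝ, 0 < η ∧ 6 * η ≤ ρ ∧ ρ + 3 * η ≤ δ :=
    ⟨min (ρ / 6) ((δ - ρ) / 3), lt_min (by linarith) (by linarith),
      by linarith [min_le_left (ρ / 6) ((δ - ρ) / 3)],
      by linarith [min_le_right (ρ / 6) ((δ - ρ) / 3)]⟩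
  -- Rounding `q` and replacing `y` by `γ` cost at most `3 * κ = ε * ρ / 4` at the witness. The
  -- remaining deficit `3 / 4 * ε * ρ` is exactly `ε / 2` times the maximal distance `3 / 2 * ρ`.
  set κ := ε * ρ / 12 with hκ
  have hκ0 : 0 < κ := by positivity
  set M := ‖(v : X)‖ + 2 * ρ with hM
  have hM0 : 0 < M := by positivity
  obtain ⟨c, hc, hcv⟩ := Metric.mem_closure_iff.1 (G.subset_closure_pts V.1 v.2) η hη
  rw [dist_eq_norm] at hcv
  have hycl : y ∈ closure (G.fns V.1) := mem_closure_fns fun γ hγ =>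
    (hV.norm_dualRestrict (sub_mem hy (G.fns_subset_dual V hγ))).ge
  obtain ⟨γ, hγ, hyγ⟩ := Metric.mem_closure_iff.1 hycl (κ / M) (by positivity)
  rw [dist_eq_norm, lt_div_iff₀ hM0] at hyγ
  have hdiff : ∀ x : X, ‖x‖ ≤ M → |y x - γ x| ≤ κ := by
    intro x hx
    have h1 := (y - γ).le_opNorm x
    have h2 := mul_le_mul_of_nonneg_left hx (norm_nonneg (y - γ))
    rw [sub_apply, Real.norm_eq_abs] at h1
    linarith
  obtain ⟨q, hq1, hq2⟩ := exists_rat_btwn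
    (show a - y v - ε * ρ + κ < a - y v - ε * ρ + 2 * κ by linarith)
  obtain ⟨s, hs1, hs2⟩ := exists_rat_btwn (show ρ - 2 * η < ρ - η by linarith)
  obtain ⟨t, ht1, ht2⟩ := exists_rat_btwn (show ρ + η < ρ + 2 * η by linarith)
  have hxM : ‖(v : X) + k‖ ≤ M := (norm_add_le _ _).trans (by linarith)
  have e1 : (v : X) + k - c = k + (v - c) := by abel
  have hlow : ρ - ‖(v : X) - c‖ ≤ ‖(v : X) + k - c‖ := by
    have := norm_sub_norm_le k (-((v : X) - c))
    rwa [norm_neg, sub_neg_eq_add, ← e1] at this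
  have hup : ‖(v : X) + k - c‖ ≤ ρ + ‖(v : X) - c‖ := e1 ▸ norm_add_le _ _
  obtain ⟨x, hxV, hx1, hx2, hx3⟩ := hV.exists_mem c hc γ hγ s t q
    ⟨v + k, by linarith, by linarith, hle.trans_lt (EReal.coe_lt_coe_iff.2 (by
      have h1 := (abs_le.1 (hdiff _ hxM)).2
      rw [map_add, map_add] at h1
      rw [map_add]
      linarith))⟩
  have e2 : x - v = (x - c) + (c - v) := by abel
  have e3 : x - c = (x - v) + (v - c) := by abel
  have hup' : ‖x - v‖ ≤ ‖x - c‖ + ‖(v : X) - c‖ := by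
    have := norm_add_le (x - c) (c - v)
    rwa [← e2, norm_sub_rev c] at this
  have hlow' : ‖x - c‖ ≤ ‖x - v‖ + ‖(v : X) - c‖ := by
    have := norm_add_le (x - v) ((v : X) - c)
    rwa [← e3] at this
  have hxnorm : ‖x‖ ≤ M := by
    have := norm_add_le (v : X) (x - v)
    rw [add_sub_cancel] at this
    linarith
  have hfin := hδV ⟨x - v, sub_mem hxV v.2⟩ (show 0 < ‖x - v‖ by linarith)
    (show ‖x - v‖ < δ by linarith)
  have hfin' : ((a + y (x - v) - ε / 2 * ‖x - v‖ : ℝ) : EReal) < f (v + (x - v)) := hfin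
  rw [add_sub_cancel] at hfin'
  have hlt := EReal.coe_lt_coe_iff.1 (hfin'.trans hx3)
  have h1 := (abs_le.1 (hdiff _ hxnorm)).1
  rw [map_sub] at hlt
  have h2 : ε / 2 * ‖x - v‖ ≤ ε / 2 * (3 / 2 * ρ) :=
    mul_le_mul_of_nonneg_left (by linarith) (half_pos hε).le
  linarith

end DualGenerator

/-! ### The rich family of rectangles -/

theorem SepSubspace.rectangle_le_rectangle {Z₁ Z₂ : Type*} [NormedAddCommGroup Z₁]
    [NormedSpace ℝ Z₁] [NormedAddCommGroup Z₂] [NormedSpace ℝ Z₂] {V V' : SepSubspace Z₁}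
    {Y Y' : SepSubspace Z₂} : V.rectangle Y ≤ V'.rectangle Y' ↔ V ≤ V' ∧ Y ≤ Y' := by
  refine ⟨fun h => ⟨fun x hx => ?_, fun y hy => ?_⟩, fun h => Submodule.prod_mono h.1 h.2⟩
  · exact (h (show (x, (0 : Z₂)) ∈ V.1.prod Y.1 from ⟨hx, zero_mem _⟩)).1
  · exact (h (show ((0 : Z₁), y) ∈ V.1.prod Y.1 from ⟨zero_mem _, hy⟩)).2

theorem SepSubspace.rectangle_injective {Z₁ Z₂ : Type*} [NormedAddCommGroup Z₁]
    [NormedSpace ℝ Z₁] [NormedAddCommGroup Z₂] [NormedSpace ℝ Z₂] {V V' : SepSubspace Z₁}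
    {Y Y' : SepSubspace Z₂} (h : V.rectangle Y = V'.rectangle Y') : V = V' ∧ Y = Y' :=
  have h1 := rectangle_le_rectangle.1 h.le
  have h2 := rectangle_le_rectangle.1 h.ge
  ⟨h1.1.antisymm h2.1, h1.2.antisymm h2.2⟩

/-- The rectangles `V × Y` with `V` closed under taking witnesses and `Y` generated by `V` form a
rich family. -/
theorem DualGenerator.isRich {X : Type*} [NormedAddCommGroup X] [NormedSpace ℝ X]
    (G : DualGenerator X) (f : X → EReal) :
    IsRich {W | ∃ V : SepSubspace X, G.IsStep f ∅ V.1 V.1 ∧ W = V.rectangle (G.dual V)} := by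
  refine ⟨fun W => ?_, fun u hu hmem => ?_⟩
  · have hfst : TopologicalSpace.IsSeparable (Prod.fst '' (W.1 : Set (X × StrongDual ℝ X))) :=
      W.2.2.image continuous_fst
    have hsnd : TopologicalSpace.IsSeparable (Prod.snd '' (W.1 : Set (X × StrongDual ℝ X))) :=
      W.2.2.image continuous_snd
    set V₀ : SepSubspace X :=
      ⟨(Submodule.span ℝ (Prod.fst '' (W.1 : Set (X × StrongDual ℝ X)))).topologicalClosure,
        Submodule.isClosed_topologicalClosure _, hfst.span.closure⟩ with hV₀
    obtain ⟨V, hV, hstep⟩ := G.exists_isStep_self f hsnd V₀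
    refine ⟨V.rectangle (G.dual V), ⟨V, hstep.mono (empty_subset _) le_rfl, rfl⟩, ?_⟩
    intro p hp
    have h0 : p.1 ∈ V₀.1 :=
      Submodule.le_topologicalClosure _ (Submodule.subset_span ⟨p, hp, rfl⟩)
    have h1 : p.1 ∈ V.1 := hV h0
    have h2 : p.2 ∈ (G.dual V).1 := hstep.subset_dual ⟨p, hp, rfl⟩
    exact Submodule.mem_prod.2 ⟨h1, h2⟩
  · choose V hV hVu using hmem
    have hmono : Monotone V := fun m n hmn =>
      (SepSubspace.rectangle_le_rectangle.1 (hVu m ▸ hVu n ▸ hu hmn)).1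
    refine ⟨_, ⟨SepSubspace.limit V, G.isStep_limit hmono fun n =>
      (hV n).mono subset_rfl (hmono n.le_succ), rfl⟩, ?_, fun W hW => ?_⟩
    · rintro _ ⟨n, rfl⟩
      rw [hVu n, SepSubspace.rectangle_le_rectangle]
      exact ⟨SepSubspace.le_limit V n, G.dual_mono (SepSubspace.le_limit V n)⟩
    · have hle : ∀ n, (V n).1.prod (G.dual (V n)).1 ≤ W.1 := fun n => by
        have := hW ⟨n, rfl⟩
        rw [hVu n] at this
        exact this
      -- An upper bound `W` need not be a rectangle, so it is tested on the two coordinate axes,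
      -- whose sum is the whole rectangle.
      have h1 : (SepSubspace.limit V).1 ≤ W.1.comap (LinearMap.inl ℝ X (StrongDual ℝ X)) :=
        SepSubspace.limit_le (W.2.1.preimage (Continuous.prodMk_left 0)) fun n x hx =>
          hle n ⟨hx, zero_mem _⟩
      have h2 : (G.dual (SepSubspace.limit V)).1 ≤
          W.1.comap (LinearMap.inr ℝ X (StrongDual ℝ X)) :=
        G.dual_limit_le hmono (W.2.1.preimage (Continuous.prodMk_right 0)) fun n x hx =>
          hle n ⟨zero_mem _, hx⟩
      intro p hp
      have hx : ((p.1, 0) : X × StrongDual ℝ X) ∈ W.1 := h1 hp.1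
      have hy : ((0, p.2) : X × StrongDual ℝ X) ∈ W.1 := h2 hp.2
      have := add_mem hx hy
      rwa [Prod.mk_add_mk, add_zero, zero_add] at this

theorem theorem3p1 {X : Type*} [NormedAddCommGroup X] [NormedSpace ℝ X] [CompleteSpace X]
    (hX : IsAsplund X) (f : X → EReal) (hf_bot : ∀ x, f x ≠ ⊥) (hf_proper : ∃ x, f x ≠ ⊤) :
    ∃ R : Set (SepSubspace (X × StrongDual ℝ X)),
      R ⊆ rectangles X (StrongDual ℝ X) ∧ IsRich R ∧
      (∀ (V₁ V₂ : SepSubspace X) (Y₁ Y₂ : SepSubspace (StrongDual ℝ X)),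
        V₁.rectangle Y₁ ∈ R → V₂.rectangle Y₂ ∈ R → V₁ ≤ V₂ → Y₁ ≤ Y₂) ∧
      ∀ (V : SepSubspace X) (Y : SepSubspace (StrongDual ℝ X)), V.rectangle Y ∈ R →
        (Isometry (fun y : Y.1 => dualRestrict V.1 (y : StrongDual ℝ X)) ∧
          Function.Surjective (fun y : Y.1 => dualRestrict V.1 (y : StrongDual ℝ X))) ∧
        ∀ v : V.1,
          dualRestrict V.1 '' (frechetSubdifferential f (v : X) ∩ (Y.1 : Set (StrongDual ℝ X))) =
              dualRestrict V.1 '' frechetSubdifferential f (v : X) ∧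
            dualRestrict V.1 '' frechetSubdifferential f (v : X) =
              frechetSubdifferential (fun w : V.1 => f (w : X)) v := by
  obtain ⟨G⟩ := hX.nonempty_dualGenerator
  refine ⟨_, ?_, G.isRich f, ?_, ?_⟩
  · rintro _ ⟨V, -, rfl⟩
    exact ⟨V, _, rfl⟩
  · rintro V₁ V₂ Y₁ Y₂ ⟨V, -, h⟩ ⟨V', -, h'⟩ hle
    obtain ⟨rfl, rfl⟩ := SepSubspace.rectangle_injective h
    obtain ⟨rfl, rfl⟩ := SepSubspace.rectangle_injective h'
    exact G.dual_mono hle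
  · rintro V Y ⟨V', hV, h⟩
    obtain ⟨rfl, rfl⟩ := SepSubspace.rectangle_injective h
    refine ⟨⟨hV.isometry, hV.surjective⟩, fun v => ?_⟩
    have hsub : frechetSubdifferential (fun w : V.1 => f (w : X)) v ⊆ dualRestrict V.1 ''
        (frechetSubdifferential f (v : X) ∩ ((G.dual V).1 : Set (StrongDual ℝ X))) := by
      intro ξ hξ
      obtain ⟨y, rfl⟩ := hV.surjective ξ
      exact ⟨y, ⟨hV.mem_frechetSubdifferential hf_bot y.2 hξ, y.2⟩, rfl⟩
    have hres : dualRestrict V.1 '' frechetSubdifferential f (v : X) ⊆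
        frechetSubdifferential (fun w : V.1 => f (w : X)) v :=
      image_subset_iff.2 fun _ hx => dualRestrict_mem_frechetSubdifferential V.1 hx
    exact ⟨(image_mono inter_subset_left).antisymm (hres.trans hsub),
      hres.antisymm (hsub.trans (image_mono inter_subset_left))⟩
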